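/- Write $(z)_k=z(z+1)\cdots(z+k-1)$ and let $$H_4(a,b;c,d;x,y)=\sum_{m=0}^{\infty}\sum_{n=0}^{\infty}\frac{(a)_{2m+n}(b)_n}{(c)_m(d)_n\,m!\,n!}x^my^n$$ be Horn's double hypergeometric series, which converges absolutely for $2\sqrt{|x|}+|y|<1$, and let ${}_2F_1(a,b;c;z)=\sum_{n\ge0}\frac{(a)_n(b)_n}{(c)_n\,n!}z^n$ for $|z|<1$. Let $q_0,q_1\in\mathbb{C}$ be such that neither $1+q_0-q_1$ nor $2q_1$ is an integer $\le 0$. For $s,t\in\mathbb{C}$ with $st\ne1$ put $$x(s,t)=\frac{(s^2-1)(t^2-1)}{4(st-1)^2},\qquad y(s,t)=\frac{2st}{st-1},$$ and let $D\subset\mathbb{C}^2$ be the connected component containing $(1,0)$ of the set of all $(s,t)$ with $st\neq1$, $2\sqrt{|x(s,t)|}+|y(s,t)|<1$, $|1-s^2|<1$ and $|t^2|<1$. Then $D$ is an open neighbourhood of $(1,0)$, and for every $(s,t)\in D$ the double series for $H_4(q_0,q_1;1+q_0-q_1,2q_1;x(s,t),y(s,t))$ converges absolutely and $$H_4\bigl(q_0,q_1;\,1+q_0-q_1,2q_1;\,x(s,t),y(s,t)\bigr)=(1-st)^{q_0}\;{}_2F_1\Bigl(\tfrac{q_0}2+\tfrac12,\tfrac{q_0}2;\,q_0-q_1+1;\,1-s^2\Bigr)\;{}_2F_1\Bigl(\tfrac{q_0}2+\tfrac12,\tfrac{q_0}2;\,q_1+\tfrac12;\,t^2\Bigr),$$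 where $(1-st)^{q_0}$ is the principal power. -/

import Mathlib

/-- The general term `(a)_{2m+n} (b)_n / ((c)_m (d)_n m! n!) x^m y^n` of Horn's double series `H₄`,
indexed by `k = (m, n)`; here `(a)_k = a (a + 1) ⋯ (a + k - 1)`. -/
noncomputable def hornH4Term (a b c d x y : ℂ) (k : ℕ × ℕ) : ℂ :=
  ((ascPochhammer ℂ (2 * k.1 + k.2)).eval a * (ascPochhammer ℂ k.2).eval b) /
    ((ascPochhammer ℂ k.1).eval c * (ascPochhammer ℂ k.2).eval d *
      (k.1.factorial : ℂ) * (k.2.factorial : ℂ)) * x ^ k.1 * y ^ k.2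

/-- Horn's hypergeometric function `H₄(a, b; c, d; x, y)`, as the sum of its double series. -/
noncomputable def hornH4 (a b c d x y : ℂ) : ℂ :=
  ∑' m : ℕ, ∑' n : ℕ, hornH4Term a b c d x y (m, n)

/-- The first argument `(s² - 1)(t² - 1) / (4 (st - 1)²)`. -/
noncomputable def baileyX (s t : ℂ) : ℂ :=
  (s ^ 2 - 1) * (t ^ 2 - 1) / (4 * (s * t - 1) ^ 2)

/-- The second argument `2st / (st - 1)`. -/
noncomputable def baileyY (s t : ℂ) : ℂ :=
  2 * s * t / (s * t - 1)

/-- The points `(s, t)` at which the arguments of `H₄` are defined and lie in its domain of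
absolute convergence `2 |x|^(1/2) + |y| < 1`, and at which both Gauss series have their arguments
`1 - s²` and `t²` in the open unit disc. -/
def baileyRegion : Set (ℂ × ℂ) :=
  {p | p.1 * p.2 ≠ 1 ∧ 2 * √‖baileyX p.1 p.2‖ + ‖baileyY p.1 p.2‖ < 1 ∧
    ‖1 - p.1 ^ 2‖ < 1 ∧ ‖p.2 ^ 2‖ < 1}

/-- The connected component of the point `(s, t) = (1, 0)` in `baileyRegion`. -/
def baileyDomain : Set (ℂ × ℂ) :=
  connectedComponentIn baileyRegion (1, 0)

-- Near `(1, 0)` the double series can be rearranged into a product. For fixed `m` the sum over `n`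
-- is a Gauss series with parameters `q₀ + 2m, q₁; 2q₁` at `2z/(z - 1)`, `z = st`. The quadratic
-- transformation `ordinaryHypergeometric_quadratic` turns it into `(1 - z)^(q₀ + 2m)` times a Gauss
-- series in `z²`, and the factor `(1 - z)^(2m)` cancels the denominator of `x^m`. What remains is
-- `(1 - st)^q₀` times Appell's `F₄` at `(X(1 - Y), Y(1 - X))` with `X = 1 - s²`, `Y = t²`.
--
-- The parameters satisfy `γ + γ' = α + β + 1`, so Bailey's theorem (`appellF4_factorization`)
-- applies: as a function of `X`, this `F₄` is a holomorphic solution at `0` of the Gauss equation,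
-- hence its value at `X = 0` times a Gauss series in `X`; the value at `X = 0` is the Gauss series
-- in `Y`.
--
-- These rearrangements are justified only for small arguments. Both sides are holomorphic along
-- every complex line inside the region, so the identity spreads over the connected component
-- (`eqOn_zero_of_differentiableOn_lines`). Convergence throughout rests on the fact that `(a)_n` is
-- comparable to `n!` up to factors `θ^n` with `θ > 1` arbitrarily close to `1`.

local notation:max "poch(" a "," n ")" => Polynomial.eval a (ascPochhammer ℂ n)

/-! ### Growth of rising factorials -/


theorem poch_ne_zero {c : ℂ} (hc : ∀ n : ℕ, c ≠ -(n : ℂ)) (n : ℕ) : poch(c, n) ≠ 0 := by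
  rw [Ne, ascPochhammer_eval_eq_zero_iff]
  rintro ⟨k, -, hk⟩
  exact hc k (by rw [hk, neg_neg])

theorem poch_add (a : ℂ) (m n : ℕ) : poch(a, m + n) = poch(a, m) * poch(a + m, n) := by
  simp [← ascPochhammer_mul, Polynomial.eval_comp]

/-- A nonnegative sequence whose ratios are eventually at most `θ` is `O(θ ^ n)`. -/
theorem exists_le_mul_pow_of_ratio_le {u : ℕ → ℝ} (hu : ∀ n, 0 ≤ u n) {θ : ℝ} (hθ : 1 ≤ θ) (N : ℕ)
    (h : ∀ n, N ≤ n → u (n + 1) ≤ θ * u n) : ∃ C : ℝ, 0 < C ∧ ∀ n, u n ≤ C * θ ^ n := by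
  refine ⟨∑ i ∈ Finset.range (N + 1), u i + 1,
    by linarith [Finset.sum_nonneg fun i (_ : i ∈ Finset.range (N + 1)) => hu i], fun n => ?_⟩
  set C := ∑ i ∈ Finset.range (N + 1), u i with hC
  have hC0 : 0 ≤ C := Finset.sum_nonneg fun i _ => hu i
  have small : ∀ n ≤ N, u n ≤ (C + 1) * θ ^ n := fun n hn => by
    have h1 : u n ≤ C :=
      Finset.single_le_sum (f := u) (fun i _ => hu i) (Finset.mem_range.2 (by omega))
    nlinarith [one_le_pow₀ hθ (n := n)]
  rcases le_total n N with hn | hn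
  · exact small n hn
  · induction n, hn using Nat.le_induction with
    | base => exact small N le_rfl
    | succ n hn ih =>
      calc u (n + 1) ≤ θ * u n := h n hn
        _ ≤ θ * ((C + 1) * θ ^ n) := by gcongr
        _ = (C + 1) * θ ^ (n + 1) := by ring

/-- The quotient of `(a)_n` by `n!` has consecutive ratios `(a + n)/(n + 1)`, which tend to `1`. -/
theorem exists_norm_poch_le (a : ℂ) {θ : ℝ} (hθ : 1 < θ) :
    ∃ C : ℝ, 0 < C ∧ ∀ n : ℕ, ‖poch(a, n)‖ ≤ C * θ ^ n * n.factorial := by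
  obtain ⟨N, hN⟩ := exists_nat_ge (‖a‖ / (θ - 1))
  obtain ⟨C, hC, h⟩ := exists_le_mul_pow_of_ratio_le
    (u := fun n => ‖poch(a, n)‖ / n.factorial) (fun n => by positivity) hθ.le N (fun n hn => by
      have h1 : ‖a‖ ≤ n * (θ - 1) := by
        rw [← div_le_iff₀ (by linarith)]
        exact hN.trans (by exact_mod_cast hn)
      have h2 : ‖a + n‖ ≤ θ * (n + 1) := by
        have := norm_add_le a n
        rw [Complex.norm_natCast] at this
        linarith
      rw [ascPochhammer_succ_eval, norm_mul, Nat.factorial_succ, Nat.cast_mul, Nat.cast_succ,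
        div_le_iff₀ (by positivity)]
      calc ‖poch(a, n)‖ * ‖a + n‖ ≤ ‖poch(a, n)‖ * (θ * (n + 1)) := by gcongr
        _ = _ := by field_simp)
  exact ⟨C, hC, fun n => (div_le_iff₀ (by positivity)).1 (h n)⟩

theorem exists_factorial_le_norm_poch {c : ℂ} (hc : ∀ n : ℕ, c ≠ -(n : ℂ)) {θ : ℝ} (hθ : 1 < θ) :
    ∃ C : ℝ, 0 < C ∧ ∀ n : ℕ, ‖poch(c, n)‖⁻¹ ≤ C * θ ^ n / n.factorial := by
  obtain ⟨N, hN⟩ := exists_nat_ge ((1 + θ * ‖c‖) / (θ - 1))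
  obtain ⟨C, hC, h⟩ := exists_le_mul_pow_of_ratio_le
    (u := fun n => n.factorial * ‖poch(c, n)‖⁻¹) (fun n => by positivity) hθ.le N (fun n hn => by
      have h1 : 1 + θ * ‖c‖ ≤ n * (θ - 1) := by
        rw [← div_le_iff₀ (by linarith)]
        exact hN.trans (by exact_mod_cast hn)
      have h2 : (n + 1 : ℝ) ≤ θ * ‖c + n‖ := by
        have h3 := norm_sub_le (c + n) c
        rw [add_sub_cancel_left, Complex.norm_natCast] at h3
        have h4 := mul_le_mul_of_nonneg_left h3 (by linarith : (0 : ℝ) ≤ θ)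
        linarith
      have h3 : 0 < ‖c + n‖ := norm_pos_iff.2 fun h => hc n (by linear_combination h)
      have h4 : ‖poch(c, n)‖ ≠ 0 := norm_ne_zero_iff.2 (poch_ne_zero hc n)
      rw [ascPochhammer_succ_eval, norm_mul, Nat.factorial_succ, Nat.cast_mul, Nat.cast_succ,
        mul_inv, ← div_eq_mul_inv ‖poch(c, n)‖⁻¹, mul_div_assoc', div_le_iff₀ h3]
      calc (n + 1) * n.factorial * ‖poch(c, n)‖⁻¹
          ≤ (θ * ‖c + n‖) * n.factorial * ‖poch(c, n)‖⁻¹ := by gcongr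
        _ = _ := by ring)
  refine ⟨C, hC, fun n => (le_div_iff₀ (by positivity)).2 ?_⟩
  rw [mul_comm]
  exact h n

/-! ### Dominating series -/

/-- By the negative binomial series the rows sum to `u^m / (1 - v)^(m+1)`, a geometric sequence of
ratio `u/(1 - v) < 1`. -/
theorem summable_choose_mul_pow_mul_pow {u v : ℝ} (hu : 0 ≤ u) (hv : 0 ≤ v) (h : u + v < 1) :
    Summable fun k : ℕ × ℕ => ((k.1 + k.2).choose k.2 : ℝ) * u ^ k.1 * v ^ k.2 := by
  have hv1 : ‖v‖ < 1 := by rw [Real.norm_of_nonneg hv]; linarith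
  have key (m : ℕ) : HasSum (fun n : ℕ => ((m + n).choose n : ℝ) * u ^ m * v ^ n)
      (u ^ m * (1 / (1 - v) ^ (m + 1))) := by
    convert! (hasSum_choose_mul_geometric_of_norm_lt_one m hv1).mul_left (u ^ m) using 2 with n
    rw [add_comm n m, Nat.choose_symm_add]
    ring
  rw [summable_prod_of_nonneg fun k => by positivity]
  refine ⟨fun m => (key m).summable, ?_⟩
  simp_rw [(key _).tsum_eq]
  have : Summable fun m : ℕ => (1 - v)⁻¹ * (u / (1 - v)) ^ m := by
    refine (summable_geometric_of_lt_one (div_nonneg hu (by linarith)) ?_).mul_left _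
    rw [div_lt_one (by linarith)]
    linarith
  refine this.congr fun m => ?_
  have : 1 - v ≠ 0 := by linarith
  rw [div_pow]
  field_simp
  ring

theorem factorial_two_mul_add_le (m n : ℕ) :
    ((2 * m + n).factorial : ℝ) / (m.factorial * m.factorial * n.factorial) ≤
      (2 * m + n).choose n * 4 ^ m := by
  have h1 : ((2 * m + n).factorial : ℝ) =
      (2 * m + n).choose n * (2 * m).factorial * n.factorial := by
    have := Nat.add_choose_mul_factorial_mul_factorial (2 * m) n
    exact_mod_cast this.symm
  have h2 : ((2 * m).factorial : ℝ) = m.centralBinom * m.factorial * m.factorial := by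
    have := Nat.add_choose_mul_factorial_mul_factorial m m
    rw [Nat.centralBinom, two_mul]
    exact_mod_cast this.symm
  have h3 : (m.centralBinom : ℝ) ≤ 4 ^ m := by exact_mod_cast Nat.centralBinom_le_four_pow m
  rw [h1, h2]
  calc _ = ((2 * m + n).choose n : ℝ) * m.centralBinom := by field_simp
    _ ≤ _ := by gcongr

/-- With Pochhammer symbols replaced by factorials, the central binomial bound `4^m` combines with
`r^m` into `(2√r)^(2m)`; the majorant is then the series of `(u + v)^N` restricted to even first
index, with `u` near `2√r` and `v` near `ρ`. Its uniformity on the polydisc is what later gives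
holomorphy. -/
theorem exists_bound_hornH4Term (a b : ℂ) {c d : ℂ} (hc : ∀ n : ℕ, c ≠ -(n : ℂ))
    (hd : ∀ n : ℕ, d ≠ -(n : ℂ)) {r ρ : ℝ} (hr : 0 ≤ r) (hρ : 0 ≤ ρ) (h : 2 * √r + ρ < 1) :
    ∃ u : ℕ × ℕ → ℝ, Summable u ∧ ∀ x y : ℂ, ‖x‖ ≤ r → ‖y‖ ≤ ρ →
      ∀ k, ‖hornH4Term a b c d x y k‖ ≤ u k := by
  obtain ⟨θ, hθ, hθ'⟩ : ∃ θ : ℝ, 1 < θ ∧ θ ^ 3 * (2 * √r + ρ) < 1 := by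
    have : ContinuousAt (fun θ : ℝ => θ ^ 3 * (2 * √r + ρ)) 1 := by fun_prop
    have h2 := this.eventually_lt_const (u := 1) (by simpa using h)
    obtain ⟨θ, h3, h4⟩ := ((h2.filter_mono nhdsWithin_le_nhds).and
      (self_mem_nhdsWithin (s := Set.Ioi (1 : ℝ)))).exists
    exact ⟨θ, h4, h3⟩
  have hθ0 : 0 < θ := by linarith
  obtain ⟨A, hA, ha⟩ := exists_norm_poch_le a hθ
  obtain ⟨B, hB, hb⟩ := exists_norm_poch_le b hθ
  obtain ⟨C, hC, hc'⟩ := exists_factorial_le_norm_poch hc hθ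
  obtain ⟨D, hD, hd'⟩ := exists_factorial_le_norm_poch hd hθ
  have hsum := summable_choose_mul_pow_mul_pow (u := θ ^ 3 * (2 * √r)) (v := θ ^ 3 * ρ)
    (by positivity) (by positivity) (by linarith)
  have hinj : Function.Injective fun k : ℕ × ℕ => (2 * k.1, k.2) := fun k l h => by
    simp only [Prod.mk.injEq] at h
    exact Prod.ext (by omega) h.2
  refine ⟨_, (hsum.comp_injective hinj).mul_left (A * B * C * D), fun x y hx hy ⟨m, n⟩ => ?_⟩
  simp only [hornH4Term, Function.comp_apply, norm_mul, norm_div, norm_pow, Complex.norm_natCast]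
  calc _ = ‖poch(a, 2 * m + n)‖ * ‖poch(b, n)‖ * ‖poch(c, m)‖⁻¹ * ‖poch(d, n)‖⁻¹
        / (m.factorial * n.factorial) * ‖x‖ ^ m * ‖y‖ ^ n := by
        rw [div_eq_mul_inv, div_eq_mul_inv]; simp only [mul_inv]; ring
    _ ≤ (A * θ ^ (2 * m + n) * (2 * m + n).factorial) * (B * θ ^ n * n.factorial) *
        (C * θ ^ m / m.factorial) * (D * θ ^ n / n.factorial)
        / (m.factorial * n.factorial) * r ^ m * ρ ^ n := by
        gcongr
        exacts [ha _, hb _, hc' _, hd' _]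
    _ = A * B * C * D * θ ^ (3 * m + 3 * n) * ((2 * m + n).factorial /
        (m.factorial * m.factorial * n.factorial)) * r ^ m * ρ ^ n := by
        field_simp; ring
    -- The exponent of `θ` is raised from `3m` to `6m` so that `θ^3` accompanies each of the `2m`
    -- factors `2√r`.
    _ ≤ A * B * C * D * θ ^ (6 * m + 3 * n) * ((2 * m + n).choose n * 4 ^ m) * r ^ m * ρ ^ n := by
        gcongr
        · exact hθ.le
        · omega
        · exact factorial_two_mul_add_le m n
    _ = _ := by
        nth_rw 1 [← Real.sq_sqrt hr, show (4 : ℝ) = 2 ^ 2 by norm_num]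
        rw [pow_add, mul_pow, mul_pow, mul_pow]
        simp only [← pow_mul]
        ring_nf

theorem summable_hornH4Term (a b : ℂ) {c d : ℂ} (hc : ∀ n : ℕ, c ≠ -(n : ℂ))
    (hd : ∀ n : ℕ, d ≠ -(n : ℂ)) {x y : ℂ} (h : 2 * √‖x‖ + ‖y‖ < 1) :
    Summable (hornH4Term a b c d x y) := by
  obtain ⟨u, hu, hle⟩ := exists_bound_hornH4Term a b hc hd (norm_nonneg x) (norm_nonneg y) h
  exact hu.of_norm_bounded (hle x y le_rfl le_rfl)

theorem hornH4_eq_tsum_prod (a b : ℂ) {c d : ℂ} (hc : ∀ n : ℕ, c ≠ -(n : ℂ))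
    (hd : ∀ n : ℕ, d ≠ -(n : ℂ)) {x y : ℂ} (h : 2 * √‖x‖ + ‖y‖ < 1) :
    hornH4 a b c d x y = ∑' k, hornH4Term a b c d x y k :=
  (summable_hornH4Term a b hc hd h).tsum_prod.symm

/-- The general term of the Gauss series. -/
noncomputable def gaussTerm (a b c z : ℂ) (n : ℕ) : ℂ :=
  poch(a, n) * poch(b, n) / (poch(c, n) * (n.factorial : ℂ)) * z ^ n

theorem ordinaryHypergeometric_eq_tsum_gaussTerm (a b c z : ℂ) :
    ordinaryHypergeometric a b c z = ∑' n, gaussTerm a b c z n := by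
  rw [ordinaryHypergeometric_eq_tsum]
  refine tsum_congr fun n => ?_
  rw [gaussTerm, smul_eq_mul, div_eq_mul_inv, mul_inv]
  ring

theorem exists_bound_gaussTerm (a b : ℂ) {c : ℂ} (hc : ∀ n : ℕ, c ≠ -(n : ℂ)) {r : ℝ}
    (hr : 0 ≤ r) (h : r < 1) : ∃ u : ℕ → ℝ, Summable u ∧ ∀ z : ℂ, ‖z‖ ≤ r →
      ∀ n, ‖gaussTerm a b c z n‖ ≤ u n := by
  obtain ⟨θ, hθ, hθ'⟩ : ∃ θ : ℝ, 1 < θ ∧ θ ^ 3 * r < 1 := by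
    have : ContinuousAt (fun θ : ℝ => θ ^ 3 * r) 1 := by fun_prop
    have h2 := this.eventually_lt_const (u := 1) (by simpa using h)
    obtain ⟨θ, h3, h4⟩ := ((h2.filter_mono nhdsWithin_le_nhds).and
      (self_mem_nhdsWithin (s := Set.Ioi (1 : ℝ)))).exists
    exact ⟨θ, h4, h3⟩
  have hθ0 : 0 < θ := by linarith
  obtain ⟨A, hA, ha⟩ := exists_norm_poch_le a hθ
  obtain ⟨B, hB, hb⟩ := exists_norm_poch_le b hθ
  obtain ⟨C, hC, hc'⟩ := exists_factorial_le_norm_poch hc hθ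
  refine ⟨_, (summable_geometric_of_lt_one (r := θ ^ 3 * r) (by positivity) hθ').mul_left
    (A * B * C), fun z hz n => ?_⟩
  simp only [gaussTerm, norm_mul, norm_div, norm_pow, Complex.norm_natCast]
  calc _ = ‖poch(a, n)‖ * ‖poch(b, n)‖ * ‖poch(c, n)‖⁻¹ / n.factorial * ‖z‖ ^ n := by
        rw [div_eq_mul_inv, div_eq_mul_inv, mul_inv]; ring
    _ ≤ (A * θ ^ n * n.factorial) * (B * θ ^ n * n.factorial) * (C * θ ^ n / n.factorial)
        / n.factorial * r ^ n := by
        gcongr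
        exacts [ha _, hb _, hc' _]
    _ = _ := by field_simp; ring

theorem differentiableOn_ordinaryHypergeometric (a b : ℂ) {c : ℂ} (hc : ∀ n : ℕ, c ≠ -(n : ℂ)) :
    DifferentiableOn ℂ (fun z : ℂ => ordinaryHypergeometric a b c z) (Metric.ball 0 1) := by
  intro z hz
  rw [mem_ball_zero_iff] at hz
  obtain ⟨r, hzr, hr⟩ := exists_between hz
  obtain ⟨u, hu, hle⟩ := exists_bound_gaussTerm a b hc ((norm_nonneg z).trans hzr.le) hr
  simp_rw [ordinaryHypergeometric_eq_tsum_gaussTerm]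
  refine ((Complex.differentiableOn_tsum_of_summable_norm hu (fun n => ?_) (Metric.isOpen_ball (x := 0))
    fun n w hw => hle w (mem_ball_zero_iff.1 hw).le n).differentiableAt
    (Metric.isOpen_ball.mem_nhds (mem_ball_zero_iff.2 hzr))).differentiableWithinAt
  unfold gaussTerm
  fun_prop

/-- The general term of Appell's double series `F₄`. -/
noncomputable def appellF4Term (α β γ γ' x y : ℂ) (k : ℕ × ℕ) : ℂ :=
  poch(α, k.1 + k.2) * poch(β, k.1 + k.2) /
    (poch(γ, k.1) * poch(γ', k.2) * (k.1.factorial : ℂ) * (k.2.factorial : ℂ)) *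
      x ^ k.1 * y ^ k.2

theorem exists_bound_appellF4Term (α β : ℂ) {γ γ' : ℂ} (hγ : ∀ n : ℕ, γ ≠ -(n : ℂ))
    (hγ' : ∀ n : ℕ, γ' ≠ -(n : ℂ)) : ∃ u : ℕ × ℕ → ℝ, Summable u ∧
      ∀ x y : ℂ, ‖x‖ ≤ 1 / 16 → ‖y‖ ≤ 1 / 16 → ∀ k, ‖appellF4Term α β γ γ' x y k‖ ≤ u k := by
  -- Each index carries three factors `5/4`, two factors `2` from bounding `(m+n)!` twice, and one
  -- `1/16`: in all `125/256 < 1/2`.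
  have hθ : (1 : ℝ) < 5 / 4 := by norm_num
  obtain ⟨A, hA, ha⟩ := exists_norm_poch_le α hθ
  obtain ⟨B, hB, hb⟩ := exists_norm_poch_le β hθ
  obtain ⟨C, hC, hc'⟩ := exists_factorial_le_norm_poch hγ hθ
  obtain ⟨D, hD, hd'⟩ := exists_factorial_le_norm_poch hγ' hθ
  have hsum := Summable.mul_of_nonneg summable_geometric_two summable_geometric_two
    (fun n => by positivity) (fun n => by positivity)
  refine ⟨_, hsum.mul_left (A * B * C * D), fun x y hx hy ⟨m, n⟩ => ?_⟩
  simp only [appellF4Term, norm_mul, norm_div, norm_pow, Complex.norm_natCast]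
  have hch : ((m + n).factorial : ℝ) ≤ 2 ^ (m + n) * m.factorial * n.factorial := by
    have h1 := Nat.add_choose_mul_factorial_mul_factorial m n
    have h2 := Nat.choose_le_two_pow (m + n) n
    rw [← h1]
    push_cast
    gcongr
    exact_mod_cast h2
  calc _ = ‖poch(α, m + n)‖ * ‖poch(β, m + n)‖ * ‖poch(γ, m)‖⁻¹ * ‖poch(γ', n)‖⁻¹
        / (m.factorial * n.factorial) * ‖x‖ ^ m * ‖y‖ ^ n := by
        rw [div_eq_mul_inv, div_eq_mul_inv]; simp only [mul_inv]; ring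
    _ ≤ (A * (5 / 4) ^ (m + n) * (2 ^ (m + n) * m.factorial * n.factorial)) *
        (B * (5 / 4) ^ (m + n) * (2 ^ (m + n) * m.factorial * n.factorial)) *
        (C * (5 / 4) ^ m / m.factorial) * (D * (5 / 4) ^ n / n.factorial)
        / (m.factorial * n.factorial) * (1 / 16) ^ m * (1 / 16) ^ n := by
        gcongr
        exacts [(ha _).trans (by gcongr), (hb _).trans (by gcongr), hc' _, hd' _]
    _ = A * B * C * D * ((125 / 256) ^ m * (125 / 256) ^ n) := by
        have h (k : ℕ) : (125 / 256 : ℝ) ^ k =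
            (5 / 4) ^ k * (5 / 4) ^ k * (5 / 4) ^ k * 2 ^ k * 2 ^ k * (1 / 16) ^ k := by
          simp only [← mul_pow]; norm_num
        rw [h, h]
        simp only [pow_add]
        field_simp
    _ ≤ _ := by
        have h (k : ℕ) : (125 / 256 : ℝ) ^ k ≤ (1 / 2) ^ k :=
          pow_le_pow_left₀ (by norm_num) (by norm_num) k
        exact mul_le_mul_of_nonneg_left
          (mul_le_mul (h m) (h n) (by positivity) (by positivity)) (by positivity)

theorem summable_appellF4Term (α β : ℂ) {γ γ' : ℂ} (hγ : ∀ n : ℕ, γ ≠ -(n : ℂ))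
    (hγ' : ∀ n : ℕ, γ' ≠ -(n : ℂ)) {x y : ℂ} (hx : ‖x‖ ≤ 1 / 16) (hy : ‖y‖ ≤ 1 / 16) :
    Summable (appellF4Term α β γ γ' x y) := by
  obtain ⟨u, hu, hle⟩ := exists_bound_appellF4Term α β hγ hγ'
  exact hu.of_norm_bounded (hle x y hx hy)

/-! ### The quadratic transformation -/

theorem hasSum_one_sub_cpow_neg (a : ℂ) {z : ℂ} (hz : ‖z‖ < 1) :
    HasSum (fun k : ℕ => poch(a, k) / (k.factorial : ℂ) * z ^ k) ((1 - z) ^ (-a)) := by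
  have h := (Complex.one_div_one_sub_cpow_hasFPowerSeriesOnBall_zero a).hasSum (y := z)
    (by rwa [Metric.mem_eball, edist_zero_right, ← ofReal_norm, ENNReal.ofReal_lt_one])
  rw [zero_add, one_div, ← Complex.cpow_neg] at h
  convert! h using 2 with k
  rw [FormalMultilinearSeries.ofScalars_apply_eq, smul_eq_mul, Ring.choose]
  have h1 := Ring.factorial_nsmul_multichoose_eq_ascPochhammer a k
  rw [Polynomial.ascPochhammer_smeval_eq_eval, nsmul_eq_mul] at h1
  rw [← h1, mul_div_cancel_left₀ _ (by exact_mod_cast k.factorial_ne_zero)]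
  congr 2
  ring

/-- `∑ₙ C(N, n) (b)ₙ (-2)ⁿ / (2b)ₙ`, the value of the terminating series `₂F₁(-N, b; 2b; 2)`. -/
noncomputable def gaussAtTwo (b : ℂ) (N : ℕ) : ℂ :=
  ∑ n ∈ Finset.range (N + 1), (N.choose n : ℂ) * (poch(b, n) * (-2) ^ n / poch(2 * b, n))

/-- Formally `φ` is integration against the normalized weight `(u(u + 2))^(b-1)` on `[-2, 0]`, whose
moments are `r n`, and `gaussAtTwo b N` is the moment of `(1 + u)^N`. The identity `hker` is
integration by parts, the integrand being the derivative of `p · (u(u + 2))^b`. It is proved on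
monomials from the recursion of `r`, then applied to `p = (1 + X)^(N+1)` using `X(X + 2) = (1 + X)^2
- 1`. -/
theorem gaussAtTwo_rec {b : ℂ} (hb : ∀ n : ℕ, 2 * b ≠ -(n : ℂ)) (N : ℕ) :
    (2 * b + N + 1) * gaussAtTwo b (N + 2) = (N + 1) * gaussAtTwo b N := by
  set r : ℕ → ℂ := fun n => poch(b, n) * (-2) ^ n / poch(2 * b, n) with hr
  let φ : Polynomial ℂ →ₗ[ℂ] ℂ := Polynomial.lsum fun n => LinearMap.mulRight ℂ (r n)
  have hφ (n : ℕ) (c : ℂ) : φ (Polynomial.monomial n c) = c * r n := by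
    simp [φ, Polynomial.lsum_apply, Polynomial.sum_monomial_index]
  have hrec (n : ℕ) : (2 * b + n) * r (n + 1) + 2 * (b + n) * r n = 0 := by
    have h1 : 2 * b + n ≠ 0 := fun h => hb n (by linear_combination h)
    have h2 := poch_ne_zero hb n
    simp only [hr, ascPochhammer_succ_eval]
    field_simp
    ring
  have hker (p : Polynomial ℂ) :
      φ (Polynomial.C (2 * b) * p * (1 + Polynomial.X) +
        Polynomial.derivative p * (Polynomial.X * (Polynomial.X + 2))) = 0 := by
    induction p using Polynomial.induction_on' with
    | add p q hp hq =>
      have h := congrArg₂ (· + ·) hp hq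
      simp only [← map_add, add_zero] at h
      rw [← h, Polynomial.derivative_add]
      congr 1
      ring
    | monomial n c =>
      have h1 : Polynomial.C (2 * b) * Polynomial.monomial n c * (1 + Polynomial.X) =
          Polynomial.monomial n (2 * b * c) + Polynomial.monomial (n + 1) (2 * b * c) := by
        simp only [← Polynomial.C_mul_X_pow_eq_monomial, map_mul]
        ring
      rw [h1, Polynomial.derivative_monomial]
      cases n with
      | zero =>
        rw [Nat.cast_zero, mul_zero, map_zero, zero_mul, add_zero, map_add, hφ, hφ]
        have := hrec 0
        push_cast at this
        linear_combination c * this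
      | succ m =>
        have h2 : Polynomial.monomial (m + 1 - 1) (c * ((m + 1 : ℕ) : ℂ)) *
            (Polynomial.X * (Polynomial.X + 2)) = Polynomial.monomial (m + 2) (c * (m + 1)) +
              Polynomial.monomial (m + 1) (2 * c * (m + 1)) := by
          have h3 : (2 : Polynomial ℂ) = Polynomial.C 2 := rfl
          simp only [← Polynomial.C_mul_X_pow_eq_monomial, map_mul, h3, Nat.add_sub_cancel,
            Nat.cast_succ]
          ring
        rw [h2, map_add, map_add, map_add, hφ, hφ, hφ, hφ]
        have := hrec (m + 1)
        push_cast at this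
        linear_combination c * this
  have hval (N : ℕ) : φ ((1 + Polynomial.X) ^ N) = gaussAtTwo b N := by
    rw [add_comm, add_pow, map_sum, gaussAtTwo]
    refine Finset.sum_congr rfl fun n _ => ?_
    rw [← hφ n, one_pow, mul_one, ← Polynomial.C_mul_X_pow_eq_monomial, mul_comm,
      Polynomial.C_eq_natCast]
  have h := hker ((1 + Polynomial.X) ^ (N + 1))
  have h2 : Polynomial.C (2 * b) * (1 + Polynomial.X) ^ (N + 1) * (1 + Polynomial.X) +
        Polynomial.derivative ((1 + Polynomial.X : Polynomial ℂ) ^ (N + 1)) *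
          (Polynomial.X * (Polynomial.X + 2)) =
      (2 * b + N + 1) • (1 + Polynomial.X) ^ (N + 2) -
        ((N : ℂ) + 1) • (1 + Polynomial.X : Polynomial ℂ) ^ N := by
    simp only [Polynomial.smul_eq_C_mul, Polynomial.derivative_pow,
      Polynomial.derivative_one, Polynomial.derivative_X, map_add, map_mul, map_natCast, map_one,
      Nat.cast_add, Nat.cast_one, Nat.add_sub_cancel]
    ring
  rw [h2, map_sub, map_smul, map_smul, hval, hval, smul_eq_mul, smul_eq_mul, sub_eq_zero] at h
  exact h

theorem gaussAtTwo_odd {b : ℂ} (hb : ∀ n : ℕ, 2 * b ≠ -(n : ℂ)) (j : ℕ) :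
    gaussAtTwo b (2 * j + 1) = 0 := by
  induction j with
  | zero =>
    have : b ≠ 0 := fun h => hb 0 (by simp [h])
    simp [gaussAtTwo, Finset.sum_range_succ]
    field_simp
    ring
  | succ j ih =>
    have h := gaussAtTwo_rec hb (2 * j + 1)
    rw [ih, mul_zero] at h
    refine (mul_eq_zero.1 h).resolve_left fun h => hb (2 * j + 2) ?_
    push_cast at h ⊢
    linear_combination h

theorem add_half_ne {b : ℂ} (hb : ∀ n : ℕ, 2 * b ≠ -(n : ℂ)) (n : ℕ) : b + 1 / 2 ≠ -(n : ℂ) :=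
  fun h => hb (2 * n + 1) (by push_cast; linear_combination 2 * h)

theorem poch_two_mul (a : ℂ) (j : ℕ) :
    poch(a, 2 * j) = 4 ^ j * poch(a / 2, j) * poch(a / 2 + 1 / 2, j) := by
  induction j with
  | zero => simp
  | succ j ih =>
    rw [mul_add, mul_one, ascPochhammer_succ_eval, ascPochhammer_succ_eval,
      ascPochhammer_succ_eval, ascPochhammer_succ_eval, ih]
    push_cast
    ring

theorem gaussAtTwo_even {b : ℂ} (hb : ∀ n : ℕ, 2 * b ≠ -(n : ℂ)) (a : ℂ) (j : ℕ) :
    poch(a, 2 * j) / ((2 * j).factorial : ℂ) * gaussAtTwo b (2 * j) =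
      poch(a / 2 + 1 / 2, j) * poch(a / 2, j) / (poch(b + 1 / 2, j) * (j.factorial : ℂ)) := by
  -- Iterating the two-step recursion from `1` gives `(1/2)_j / (b + 1/2)_j`, where `(1/2)_j = (2j)!
  -- / (4^j j!)`.
  have key : gaussAtTwo b (2 * j) * poch(b + 1 / 2, j) * (4 ^ j * (j.factorial : ℂ)) =
      ((2 * j).factorial : ℂ) := by
    induction j with
    | zero => simp [gaussAtTwo]
    | succ j ih =>
      have h := gaussAtTwo_rec hb (2 * j)
      rw [mul_add, mul_one, ascPochhammer_succ_eval, Nat.factorial_succ, Nat.factorial_succ,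
        Nat.factorial_succ]
      push_cast at h ⊢
      rw [← ih]
      linear_combination poch(b + 1 / 2, j) * 4 ^ j * (j.factorial : ℂ) * 2 * (j + 1) * h
  have h1 := poch_ne_zero (add_half_ne hb) j
  have h2 : ((2 * j).factorial : ℂ) ≠ 0 := by exact_mod_cast Nat.factorial_ne_zero _
  have h3 : (j.factorial : ℂ) ≠ 0 := by exact_mod_cast Nat.factorial_ne_zero _
  rw [div_mul_eq_mul_div, div_eq_div_iff h2 (mul_ne_zero h1 h3), poch_two_mul]
  linear_combination poch(a / 2, j) * poch(a / 2 + 1 / 2, j) * key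

/-- Up to powers of `θ` the terms are `C(m+n, n) (2|z|)^m |z|^n`, summable when `3|z| < 1`; this is
the origin of the bound `1/3`. -/
theorem summable_quadratic (a : ℂ) {b : ℂ} (hb : ∀ n : ℕ, 2 * b ≠ -(n : ℂ)) {z : ℂ}
    (hz : ‖z‖ < 1 / 3) : Summable fun k : ℕ × ℕ =>
      poch(a, k.1 + k.2) * poch(b, k.1) * (-2) ^ k.1 /
        (poch(2 * b, k.1) * (k.1.factorial : ℂ) * (k.2.factorial : ℂ)) * z ^ (k.1 + k.2) := by
  obtain ⟨θ, hθ, hθ'⟩ : ∃ θ : ℝ, 1 < θ ∧ θ ^ 3 * (3 * ‖z‖) < 1 := by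
    have : ContinuousAt (fun θ : ℝ => θ ^ 3 * (3 * ‖z‖)) 1 := by fun_prop
    have h2 := this.eventually_lt_const (u := 1) (by linarith)
    obtain ⟨θ, h3, h4⟩ := ((h2.filter_mono nhdsWithin_le_nhds).and
      (self_mem_nhdsWithin (s := Set.Ioi (1 : ℝ)))).exists
    exact ⟨θ, h4, h3⟩
  have hθ0 : 0 < θ := by linarith
  obtain ⟨A, hA, ha⟩ := exists_norm_poch_le a hθ
  obtain ⟨B, hB, hb'⟩ := exists_norm_poch_le b hθ
  obtain ⟨C, hC, hc'⟩ := exists_factorial_le_norm_poch hb hθ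
  have hsum := summable_choose_mul_pow_mul_pow (u := θ ^ 3 * (2 * ‖z‖)) (v := θ ^ 3 * ‖z‖)
    (by positivity) (by positivity) (by linarith)
  refine (hsum.mul_left (A * B * C)).of_norm_bounded fun ⟨m, n⟩ => ?_
  simp only [norm_mul, norm_div, norm_pow, norm_neg, Complex.norm_natCast, Complex.norm_ofNat]
  have hch : ((m + n).factorial : ℝ) = (m + n).choose n * m.factorial * n.factorial := by
    exact_mod_cast (Nat.add_choose_mul_factorial_mul_factorial m n).symm
  calc _ = ‖poch(a, m + n)‖ * ‖poch(b, m)‖ * ‖poch(2 * b, m)‖⁻¹ * 2 ^ m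
        / (m.factorial * n.factorial) * ‖z‖ ^ (m + n) := by
        rw [div_eq_mul_inv, div_eq_mul_inv]; simp only [mul_inv]; ring
    _ ≤ (A * θ ^ (m + n) * (m + n).factorial) * (B * θ ^ m * m.factorial) *
        (C * θ ^ m / m.factorial) * 2 ^ m / (m.factorial * n.factorial) * ‖z‖ ^ (m + n) := by
        gcongr
        exacts [ha _, hb' _, hc' _]
    _ = A * B * C * (θ ^ (3 * m + n) * (m + n).choose n * 2 ^ m * ‖z‖ ^ (m + n)) := by
        rw [hch]; field_simp; ring
    _ ≤ A * B * C * (θ ^ (3 * m + 3 * n) * (m + n).choose n * 2 ^ m * ‖z‖ ^ (m + n)) := by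
        gcongr
        · exact hθ.le
        · omega
    _ = _ := by
        simp only [mul_pow, pow_add, ← pow_mul]
        ring

/-- One absolutely convergent double series `F` is summed in two ways. Rows are binomial series for
`(1 - z)^(-a-n)` and produce the left side; antidiagonals have coefficients `gaussAtTwo b N`, which
vanish for odd `N` and leave a Gauss series in `z²`. -/
theorem ordinaryHypergeometric_quadratic (a : ℂ) {b : ℂ} (hb : ∀ n : ℕ, 2 * b ≠ -(n : ℂ)) {z : ℂ}
    (hz : ‖z‖ < 1 / 3) :
    ∑' n, gaussTerm a b (2 * b) (2 * z / (z - 1)) n =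
      (1 - z) ^ a * ∑' j, gaussTerm (a / 2 + 1 / 2) (a / 2) (b + 1 / 2) (z ^ 2) j := by
  have hz1 : ‖z‖ < 1 := by linarith
  have hz0 : 1 - z ≠ 0 := fun h => by
    rw [← sub_eq_zero.1 h, norm_one] at hz1
    exact lt_irrefl _ hz1
  obtain ⟨F, hF⟩ : ∃ F : ℕ × ℕ → ℂ, F = fun k =>
      poch(a, k.1 + k.2) * poch(b, k.1) * (-2) ^ k.1 /
        (poch(2 * b, k.1) * (k.1.factorial : ℂ) * (k.2.factorial : ℂ)) * z ^ (k.1 + k.2) :=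
    ⟨_, rfl⟩
  have hs : Summable F := hF ▸ summable_quadratic a hb hz
  have h1 : ∑' k, F k = (1 - z) ^ (-a) * ∑' n, gaussTerm a b (2 * b) (2 * z / (z - 1)) n := by
    rw [hs.tsum_prod, ← tsum_mul_left]
    refine tsum_congr fun n => ?_
    have h2 := (hasSum_one_sub_cpow_neg (a + n) hz1).mul_left
      (poch(a, n) * poch(b, n) / (poch(2 * b, n) * (n.factorial : ℂ)) * (-2 * z) ^ n)
    rw [neg_add, Complex.cpow_add _ _ hz0, Complex.cpow_neg _ (n : ℂ), Complex.cpow_natCast] at h2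
    have h3 : 2 * z / (z - 1) = (-2 * z) * (1 - z)⁻¹ := by
      rw [← div_eq_mul_inv, ← neg_sub 1 z, div_neg, neg_mul, neg_div]
    rw [gaussTerm, h3, mul_pow, inv_pow]
    refine (tsum_congr fun k => ?_).trans (h2.tsum_eq.trans (by ring))
    simp only [hF, poch_add, mul_pow, pow_add]
    simp only [div_eq_mul_inv, mul_inv]
    ring
  have h2 : ∑' k, F k = ∑' j, gaussTerm (a / 2 + 1 / 2) (a / 2) (b + 1 / 2) (z ^ 2) j := by
    let e := Finset.HasAntidiagonal.sigmaAntidiagonalEquivProd (A := ℕ)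
    have hs' : Summable fun c : (Σ N : ℕ, Finset.HasAntidiagonal.antidiagonal N) =>
        F (c.2 : ℕ × ℕ) := e.summable_iff.2 hs
    have hF' : ∑' k, F k = ∑' N : ℕ, ∑' c : Finset.HasAntidiagonal.antidiagonal N, F (c : ℕ × ℕ) :=
      (e.tsum_eq F).symm.trans hs'.tsum_sigma
    rw [hF']
    have h3 (N : ℕ) : ∑' c : Finset.HasAntidiagonal.antidiagonal N, F (c : ℕ × ℕ) =
        poch(a, N) / (N.factorial : ℂ) * gaussAtTwo b N * z ^ N := by
      rw [Finset.tsum_subtype, Finset.Nat.sum_antidiagonal_eq_sum_range_succ_mk, gaussAtTwo,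
        Finset.mul_sum, Finset.sum_mul]
      refine Finset.sum_congr rfl fun n hn => ?_
      have hn : n ≤ N := Nat.lt_succ_iff.1 (Finset.mem_range.1 hn)
      have h4 : (N.factorial : ℂ) ≠ 0 := by exact_mod_cast Nat.factorial_ne_zero _
      simp only [hF, Nat.add_sub_cancel' hn, Nat.cast_choose ℂ hn]
      field_simp
    simp_rw [h3]
    have hs2 : Summable fun N : ℕ => poch(a, N) / (N.factorial : ℂ) * gaussAtTwo b N * z ^ N := by
      have := hs'.sigma
      simpa only [← h3] using! this
    generalize hG : (fun N : ℕ => poch(a, N) / (N.factorial : ℂ) * gaussAtTwo b N * z ^ N) = G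
      at hs2 ⊢
    rw [← tsum_even_add_odd (hs2.comp_injective fun i j h => by simpa using h)
      (hs2.comp_injective fun i j h => by simpa using h)]
    simp only [← hG, gaussAtTwo_odd hb, mul_zero, zero_mul, tsum_zero, add_zero,
      gaussAtTwo_even hb, pow_mul]
    rfl
  rw [← h2, h1, ← mul_assoc, ← Complex.cpow_add _ _ hz0, add_neg_cancel, Complex.cpow_zero,
    one_mul]

/-! ### Analytic solutions of the hypergeometric equation -/

theorem iteratedDeriv_mul_self_zero {h : ℂ → ℂ} (hh : AnalyticAt ℂ h 0) (n : ℕ) :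
    iteratedDeriv n (fun z => z * h z) 0 = n * iteratedDeriv (n - 1) h 0 := by
  rw [iteratedDeriv_fun_mul contDiffAt_fun_id hh.contDiffAt]
  simp only [iteratedDeriv_fun_id_zero]
  cases n with
  | zero => simp
  | succ n =>
    rw [Finset.sum_eq_single 1]
    · simp
    · intro i _ hi
      simp [hi]
    · simp

theorem iteratedDeriv_succ_of_hypergeometric_eq {f : ℂ → ℂ} {α β γ : ℂ} (hf : AnalyticAt ℂ f 0)
    (hode : ∀ᶠ z in nhds (0 : ℂ), z * (1 - z) * deriv (deriv f) z +
      (γ - (α + β + 1) * z) * deriv f z - α * β * f z = 0) (p : ℕ) :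
    (γ + p) * iteratedDeriv (p + 1) f 0 = (α + p) * (β + p) * iteratedDeriv p f 0 := by
  have h1 : AnalyticAt ℂ (deriv f) 0 := hf.deriv
  have h2 : AnalyticAt ℂ (deriv (deriv f)) 0 := h1.deriv
  have h3 : AnalyticAt ℂ (fun z => z * deriv (deriv f) z) 0 := analyticAt_id.mul h2
  have h4 : AnalyticAt ℂ (fun z => z * deriv f z) 0 := analyticAt_id.mul h1
  have h5 : AnalyticAt ℂ (fun z => z * (z * deriv (deriv f) z)) 0 := analyticAt_id.mul h3
  have e : (fun z => z * deriv (deriv f) z + γ * deriv f z) =ᶠ[nhds 0] fun z =>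
      z * (z * deriv (deriv f) z) + ((α + β + 1) * (z * deriv f z) + α * β * f z) := by
    filter_upwards [hode] with z hz
    linear_combination hz
  have key := e.iteratedDeriv_eq p
  have c1 : AnalyticAt ℂ (fun z => γ * deriv f z) 0 := analyticAt_const.mul h1
  have c2 : AnalyticAt ℂ (fun z => (α + β + 1) * (z * deriv f z)) 0 := analyticAt_const.mul h4
  have c3 : AnalyticAt ℂ (fun z => α * β * f z) 0 := analyticAt_const.mul hf
  rw [iteratedDeriv_fun_add h3.contDiffAt c1.contDiffAt,
    iteratedDeriv_fun_add h5.contDiffAt (c2.fun_add c3).contDiffAt,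
    iteratedDeriv_fun_add c2.contDiffAt c3.contDiffAt,
    iteratedDeriv_const_mul_field, iteratedDeriv_const_mul_field, iteratedDeriv_const_mul_field,
    iteratedDeriv_mul_self_zero h3, iteratedDeriv_mul_self_zero h2,
    iteratedDeriv_mul_self_zero h2, iteratedDeriv_mul_self_zero h1, ← iteratedDeriv_succ',
    ← iteratedDeriv_succ', ← iteratedDeriv_succ', ← iteratedDeriv_succ', ← iteratedDeriv_succ'] at key
  -- The truncated indices `p - 1` and `p - 1 - 1` require `p = 0` and `p = 1` to be treated apart.
  rcases p with _ | _ | p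
  · simp at key ⊢
    linear_combination key
  · simp at key ⊢
    linear_combination key
  · simp only [Nat.add_sub_cancel, ← iteratedDeriv_succ'] at key
    push_cast at key ⊢
    linear_combination key

/-- At the regular singular point `0` the equation gives a two-term recursion for the Taylor
coefficients, and `γ + n ≠ 0` lets it determine all of them from `f 0`. -/
theorem eq_mul_tsum_gaussTerm_of_hypergeometric_eq {f : ℂ → ℂ} {α β γ : ℂ} {R : ℝ}
    (hγ : ∀ n : ℕ, γ ≠ -(n : ℂ)) (hf : DifferentiableOn ℂ f (Metric.ball 0 R))
    (hode : ∀ z ∈ Metric.ball (0 : ℂ) R, z * (1 - z) * deriv (deriv f) z +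
      (γ - (α + β + 1) * z) * deriv f z - α * β * f z = 0) {z : ℂ}
    (hz : z ∈ Metric.ball (0 : ℂ) R) : f z = f 0 * ∑' n, gaussTerm α β γ z n := by
  have hR : Metric.ball (0 : ℂ) R ∈ nhds 0 :=
    Metric.ball_mem_nhds 0 (Metric.pos_of_mem_ball hz)
  have hrec := iteratedDeriv_succ_of_hypergeometric_eq (hf.analyticAt hR)
    (Filter.eventually_of_mem hR hode)
  have hcoef (n : ℕ) : iteratedDeriv n f 0 = f 0 * (poch(α, n) * poch(β, n) / poch(γ, n)) := by
    induction n with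
    | zero => simp
    | succ n ih =>
      have h1 : γ + n ≠ 0 := fun h => hγ n (by linear_combination h)
      have h2 := poch_ne_zero hγ n
      apply mul_left_cancel₀ h1
      rw [hrec, ih]
      simp only [ascPochhammer_succ_eval]
      field_simp
  rw [← Complex.taylorSeries_eq_on_ball' hz hf, ← tsum_mul_left]
  refine tsum_congr fun n => ?_
  rw [hcoef, gaussTerm, sub_zero]
  simp only [div_eq_mul_inv, mul_inv]
  ring

/-! ### Bailey's factorization of `F₄` -/

/-- The effect of the hypergeometric operator in `X` on `(X (1 - Y)) ^ m (Y (1 - X)) ^ n`. -/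
theorem hypergeometric_operator_monomial {α β γ γ' : ℂ} (h : γ + γ' = α + β + 1) (Y : ℂ) (m n : ℕ)
    (X : ℂ) :
    let φ : ℂ → ℂ := fun X => (X * (1 - Y)) ^ m * (Y * (1 - X)) ^ n
    let x := X * (1 - Y)
    let y := Y * (1 - X)
    X * (1 - X) * deriv (deriv φ) X + (γ - (α + β + 1) * X) * deriv φ X - α * β * φ X =
      (1 - Y) * (m * (m - 1 + γ) * x ^ (m - 1) * y ^ n) +
      Y * (n * (n - 1 + γ') * x ^ m * y ^ (n - 1)) -
        (m + n + α) * (m + n + β) * x ^ m * y ^ n := by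
  have d1 (m n : ℕ) (X : ℂ) : HasDerivAt (fun X => (X * (1 - Y)) ^ m * (Y * (1 - X)) ^ n)
      (m * (X * (1 - Y)) ^ (m - 1) * (1 - Y) * (Y * (1 - X)) ^ n +
        (X * (1 - Y)) ^ m * (n * (Y * (1 - X)) ^ (n - 1) * (-Y))) X := by
    have hx : HasDerivAt (fun X => X * (1 - Y)) (1 - Y) X := by
      simpa using (hasDerivAt_id X).mul_const (1 - Y)
    have hy : HasDerivAt (fun X => Y * (1 - X)) (-Y) X := by
      simpa using ((hasDerivAt_id X).const_sub 1).const_mul Y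
    exact (hx.pow m).mul (hy.pow n)
  intro φ x y
  have e1 : deriv φ = fun X => (m * (1 - Y)) * ((X * (1 - Y)) ^ (m - 1) * (Y * (1 - X)) ^ n) +
      (n * (-Y)) * ((X * (1 - Y)) ^ m * (Y * (1 - X)) ^ (n - 1)) := by
    funext X
    rw [(d1 m n X).deriv]
    ring
  have e2 := (((d1 (m - 1) n X).const_mul (m * (1 - Y))).add
    ((d1 m (n - 1) X).const_mul (n * (-Y)))).deriv
  rw [e1]
  erw [e2]
  -- The relation between the parameters enters here: the first-order terms hitting `y` combine to
  -- the coefficient `γ'`.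
  obtain rfl : γ' = α + β + 1 - γ := by linear_combination h
  simp only [φ, x, y]
  rcases m with _ | _ | m <;> rcases n with _ | _ | n <;>
  simp only [Nat.add_sub_cancel, Nat.cast_zero, Nat.cast_succ, Nat.zero_sub, Nat.sub_self,
      Nat.zero_add, pow_zero] <;> ring

theorem poch_mul_add (a : ℂ) (n : ℕ) : poch(a, n) * (a + n) = a * poch(a + 1, n) := by
  have := poch_add a 1 n
  rw [add_comm 1 n, ascPochhammer_succ_eval] at this
  simpa using this

/-- Both difference equations of the coefficients of `F₄` produce the same shifted series. -/
theorem hasSum_appellF4_operator (α β : ℂ) {γ γ' : ℂ} (hγ : ∀ n : ℕ, γ ≠ -(n : ℂ))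
    (hγ' : ∀ n : ℕ, γ' ≠ -(n : ℂ)) {x y : ℂ} (hx : ‖x‖ ≤ 1 / 16) (hy : ‖y‖ ≤ 1 / 16) (Y : ℂ) :
    HasSum (fun k : ℕ × ℕ => appellF4Term α β γ γ' 1 1 k *
      ((1 - Y) * (k.1 * (k.1 - 1 + γ) * x ^ (k.1 - 1) * y ^ k.2) +
        Y * (k.2 * (k.2 - 1 + γ') * x ^ k.1 * y ^ (k.2 - 1)) -
        (k.1 + k.2 + α) * (k.1 + k.2 + β) * x ^ k.1 * y ^ k.2)) 0 := by
  set Q : ℕ × ℕ → ℂ := fun k => appellF4Term α β γ γ' 1 1 k *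
    ((k.1 + k.2 + α) * (k.1 + k.2 + β) * x ^ k.1 * y ^ k.2) with hQ
  -- Since `(α)_N (α + N) = α (α + 1)_N`, `Q` is `αβ` times an `F₄` series with `α`, `β` raised by
  -- one.
  have hQs : Summable Q := by
    refine ((summable_appellF4Term (α + 1) (β + 1) hγ hγ' hx hy).mul_left (α * β)).congr
      fun k => ?_
    have h1 := poch_mul_add α (k.1 + k.2)
    have h2 := poch_mul_add β (k.1 + k.2)
    push_cast at h1 h2
    simp only [hQ, appellF4Term, one_pow, mul_one]
    simp only [div_eq_mul_inv]
    linear_combination (-(β * poch(β + 1, k.1 + k.2)) * h1 -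
      (α + (k.1 + k.2)) * poch(α, k.1 + k.2) * h2) *
        (poch(γ, k.1) * poch(γ', k.2) * (k.1.factorial : ℂ) * (k.2.factorial : ℂ))⁻¹ *
        x ^ k.1 * y ^ k.2
  have hf (n : ℕ) : (n.factorial : ℂ) ≠ 0 := by exact_mod_cast n.factorial_ne_zero
  have h1 : HasSum (fun k : ℕ × ℕ => appellF4Term α β γ γ' 1 1 k *
      (k.1 * (k.1 - 1 + γ) * x ^ (k.1 - 1) * y ^ k.2)) (∑' k, Q k) := by
    have hi : Function.Injective fun k : ℕ × ℕ => (k.1 + 1, k.2) := fun k l h => by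
      simp only [Prod.mk.injEq] at h
      exact Prod.ext (by omega) h.2
    rw [← hi.hasSum_iff]
    · convert! hQs.hasSum using 1
      funext ⟨m, n⟩
      have h3 : γ + m ≠ 0 := fun h => hγ m (by linear_combination h)
      have h4 := poch_ne_zero hγ m
      have h5 := poch_ne_zero hγ' n
      have h6 := hf m
      have h7 := hf n
      have h8 : (m + 1 : ℂ) ≠ 0 := by exact_mod_cast m.succ_ne_zero
      simp only [hQ, Function.comp_apply, appellF4Term, one_pow, mul_one, Nat.factorial_succ,
        add_right_comm m 1 n, ascPochhammer_succ_eval, Nat.add_sub_cancel]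
      push_cast
      field_simp
      ring
    · rintro ⟨m, n⟩ h
      cases m with
      | zero => simp
      | succ m => exact absurd ⟨(m, n), rfl⟩ h
  have h2 : HasSum (fun k : ℕ × ℕ => appellF4Term α β γ γ' 1 1 k *
      (k.2 * (k.2 - 1 + γ') * x ^ k.1 * y ^ (k.2 - 1))) (∑' k, Q k) := by
    have hi : Function.Injective fun k : ℕ × ℕ => (k.1, k.2 + 1) := fun k l h => by
      simp only [Prod.mk.injEq] at h
      exact Prod.ext h.1 (by omega)
    rw [← hi.hasSum_iff]
    · convert! hQs.hasSum using 1
      funext ⟨m, n⟩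
      have h3 : γ' + n ≠ 0 := fun h => hγ' n (by linear_combination h)
      have h4 := poch_ne_zero hγ m
      have h5 := poch_ne_zero hγ' n
      have h6 := hf m
      have h7 := hf n
      have h8 : (n + 1 : ℂ) ≠ 0 := by exact_mod_cast n.succ_ne_zero
      simp only [hQ, Function.comp_apply, appellF4Term, one_pow, mul_one, Nat.factorial_succ,
        ← add_assoc, ascPochhammer_succ_eval, Nat.add_sub_cancel]
      push_cast
      field_simp
      ring
    · rintro ⟨m, n⟩ h
      cases n with
      | zero => simp
      | succ n => exact absurd ⟨(m, n), rfl⟩ h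
  -- All three series have the same sum, with total weight `(1 - Y) + Y - 1 = 0`.
  convert! ((h1.mul_left (1 - Y)).add (h2.mul_left Y)).sub hQs.hasSum using 1
  · funext k
    simp only [hQ]
    ring
  · ring

theorem tsum_appellF4Term_zero_left (α β γ γ' y : ℂ) :
    ∑' k, appellF4Term α β γ γ' 0 y k = ∑' n, gaussTerm α β γ' y n := by
  have hi : Function.Injective fun n : ℕ => ((0, n) : ℕ × ℕ) := fun m n h => by simpa using h
  rw [← hi.tsum_eq]
  · refine tsum_congr fun n => ?_
    simp [appellF4Term, gaussTerm]
  · rintro ⟨m, n⟩ h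
    rcases m with _ | m
    · exact ⟨n, rfl⟩
    · simp [appellF4Term] at h

theorem norm_mul_one_sub_le {Z W : ℂ} (hZ : ‖Z‖ < 1 / 32) (hW : ‖W‖ < 1 / 32) :
    ‖Z * (1 - W)‖ ≤ 1 / 16 := by
  have h1 := norm_sub_le 1 W
  rw [norm_one] at h1
  rw [norm_mul]
  nlinarith [norm_nonneg Z, norm_nonneg (1 - W)]

/-- With `Y` fixed, the series is differentiated termwise in `X`, which locally uniform convergence
of holomorphic partial sums allows, and the Gauss operator annihilates it. -/
theorem appellF4_factorization {α β γ γ' : ℂ} (hγ : ∀ n : ℕ, γ ≠ -(n : ℂ))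
    (hγ' : ∀ n : ℕ, γ' ≠ -(n : ℂ)) (h : γ + γ' = α + β + 1) {X Y : ℂ} (hX : ‖X‖ < 1 / 32)
    (hY : ‖Y‖ < 1 / 32) :
    ∑' k, appellF4Term α β γ γ' (X * (1 - Y)) (Y * (1 - X)) k =
      (∑' n, gaussTerm α β γ X n) * ∑' n, gaussTerm α β γ' Y n := by
  set U : Set ℂ := Metric.ball 0 (1 / 32) with hU
  have hUo : IsOpen U := Metric.isOpen_ball
  obtain ⟨u, hu, hle⟩ := exists_bound_appellF4Term α β hγ hγ'
  let φ : ℕ × ℕ → ℂ → ℂ := fun k X => (X * (1 - Y)) ^ k.1 * (Y * (1 - X)) ^ k.2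
  let F : ℕ × ℕ → ℂ → ℂ := fun k X => appellF4Term α β γ γ' 1 1 k * φ k X
  have hF (k : ℕ × ℕ) (X : ℂ) : appellF4Term α β γ γ' (X * (1 - Y)) (Y * (1 - X)) k = F k X := by
    simp only [appellF4Term, F, φ]
    ring
  simp_rw [hF]
  have hφd (k : ℕ × ℕ) : Differentiable ℂ (φ k) := by simp only [φ]; fun_prop
  have hφd' (k : ℕ × ℕ) : Differentiable ℂ (deriv (φ k)) := (hφd k).deriv
  have hunif := (tendstoUniformlyOn_tsum (f := F) (s := U) hu fun k Z hZ => by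
    rw [← hF]
    rw [hU, mem_ball_zero_iff] at hZ
    exact hle _ _ (norm_mul_one_sub_le hZ hY) (norm_mul_one_sub_le hY hZ) k).tendstoLocallyUniformlyOn
  have e0 : (fun (s : Finset (ℕ × ℕ)) (Z : ℂ) => ∑ k ∈ s, F k Z) = fun s Z =>
      ∑ k ∈ s, appellF4Term α β γ γ' 1 1 k * φ k Z := rfl
  have e1 : deriv ∘ (fun (s : Finset (ℕ × ℕ)) (Z : ℂ) => ∑ k ∈ s, F k Z) = fun s Z =>
      ∑ k ∈ s, appellF4Term α β γ γ' 1 1 k * deriv (φ k) Z := by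
    funext s Z
    rw [e0, Function.comp_apply, deriv_fun_sum fun k _ => ((hφd k).const_mul _).differentiableAt]
    simp only [deriv_const_mul_field]
  have e2 : deriv ∘ (fun (s : Finset (ℕ × ℕ)) (Z : ℂ) =>
      ∑ k ∈ s, appellF4Term α β γ γ' 1 1 k * deriv (φ k) Z) = fun s Z =>
      ∑ k ∈ s, appellF4Term α β γ γ' 1 1 k * deriv (deriv (φ k)) Z := by
    funext s Z
    rw [Function.comp_apply, deriv_fun_sum fun k _ => ((hφd' k).const_mul _).differentiableAt]
    simp only [deriv_const_mul_field]
  have hd0 : ∀ s : Finset (ℕ × ℕ), DifferentiableOn ℂ (fun Z => ∑ k ∈ s, F k Z) U := fun s =>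
    DifferentiableOn.fun_sum fun k _ => ((hφd k).const_mul _).differentiableOn
  have hunif1 := hunif.deriv (Filter.Eventually.of_forall hd0) hUo
  rw [e1] at hunif1
  have hunif2 := hunif1.deriv (Filter.Eventually.of_forall fun s =>
    DifferentiableOn.fun_sum fun k _ => ((hφd' k).const_mul _).differentiableOn) hUo
  rw [e2] at hunif2
  have hdiff := hunif.differentiableOn (Filter.Eventually.of_forall hd0) hUo
  have hmain := eq_mul_tsum_gaussTerm_of_hypergeometric_eq (α := α) (β := β) hγ hdiff
    (fun Z hZ => by
      have hZ' : ‖Z‖ < 1 / 32 := mem_ball_zero_iff.1 hZ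
      have hlim := (((hunif2.tendsto_at hZ).const_mul (Z * (1 - Z))).add
        ((hunif1.tendsto_at hZ).const_mul (γ - (α + β + 1) * Z))).sub
        ((hunif.tendsto_at hZ).const_mul (α * β))
      -- The operator applied to the partial sums tends both to the operator applied to the sum and
      -- to `0`.
      refine tendsto_nhds_unique hlim ?_
      refine (hasSum_appellF4_operator α β hγ hγ' (norm_mul_one_sub_le hZ' hY) (norm_mul_one_sub_le hY hZ') Y).congr fun s => ?_
      rw [Finset.mul_sum, Finset.mul_sum, Finset.mul_sum, ← Finset.sum_add_distrib,
        ← Finset.sum_sub_distrib]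
      refine Finset.sum_congr rfl fun k _ => ?_
      beta_reduce
      rw [← hypergeometric_operator_monomial h Y k.1 k.2 Z]
      simp only [F, φ]
      ring) (mem_ball_zero_iff.2 hX)
  rw [hmain, mul_comm]
  congr 1
  rw [← tsum_appellF4Term_zero_left α β γ γ']
  refine tsum_congr fun k => ?_
  rw [← hF, zero_mul, sub_zero, mul_one]

/-! ### The identity near `(1, 0)` -/

/-- Splitting `(a)_{2m+n} = (a)_{2m} (a + 2m)_n` exposes a Gauss series in `n`. Its quadratic
transformation yields `(1 - st)^(2m)` and duplication of `(a)_{2m}` yields `4^m`, which together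
clear the denominator of `baileyX s t ^ m`. -/
theorem tsum_hornH4Term_eq (a b c : ℂ) (hb : ∀ n : ℕ, 2 * b ≠ -(n : ℂ)) {s t : ℂ}
    (hst : ‖s * t‖ < 1 / 3) (m : ℕ) :
    ∑' n, hornH4Term a b c (2 * b) (baileyX s t) (baileyY s t) (m, n) =
      (1 - s * t) ^ a * ∑' j, appellF4Term (a / 2 + 1 / 2) (a / 2) c (b + 1 / 2)
        ((1 - s ^ 2) * (1 - t ^ 2)) (t ^ 2 * (1 - (1 - s ^ 2))) (m, j) := by
  have hz0 : 1 - s * t ≠ 0 := fun h => by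
    rw [← sub_eq_zero.1 h, norm_one] at hst
    norm_num at hst
  have h1 (n : ℕ) : hornH4Term a b c (2 * b) (baileyX s t) (baileyY s t) (m, n) =
      poch(a, 2 * m) / (poch(c, m) * (m.factorial : ℂ)) * baileyX s t ^ m *
        gaussTerm (a + (2 * m : ℕ)) b (2 * b) (2 * (s * t) / (s * t - 1)) n := by
    simp only [hornH4Term, gaussTerm, baileyY, poch_add, mul_assoc 2 s t]
    simp only [div_eq_mul_inv, mul_inv]
    ring
  simp_rw [h1]
  rw [tsum_mul_left, ordinaryHypergeometric_quadratic _ hb hst, Complex.cpow_add _ _ hz0,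
    Complex.cpow_natCast, ← tsum_mul_left, ← tsum_mul_left, ← tsum_mul_left]
  refine tsum_congr fun j => ?_
  have e1 : (a + (2 * m : ℕ)) / 2 = a / 2 + m := by push_cast; ring
  have e2 : a / 2 + m + 1 / 2 = a / 2 + 1 / 2 + m := by ring
  have e3 : baileyX s t ^ m * (1 - s * t) ^ (2 * m) * 4 ^ m = ((1 - s ^ 2) * (1 - t ^ 2)) ^ m := by
    rw [pow_mul, ← mul_pow, ← mul_pow]
    congr 1
    have : s * t - 1 ≠ 0 := fun h => hz0 (by linear_combination -h)
    rw [baileyX]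
    field_simp
    ring
  have e4 : t ^ 2 * (1 - (1 - s ^ 2)) = (s * t) ^ 2 := by ring
  simp only [gaussTerm, appellF4Term, e1, e2, e4, poch_two_mul, poch_add, ← e3]
  simp only [div_eq_mul_inv, mul_inv]
  ring

theorem hornH4_eq_of_small {q₀ q₁ : ℂ} (hc : ∀ n : ℕ, 1 + q₀ - q₁ ≠ -(n : ℂ))
    (hd : ∀ n : ℕ, 2 * q₁ ≠ -(n : ℂ)) {s t : ℂ} (hst : ‖s * t‖ < 1 / 3)
    (hs : ‖1 - s ^ 2‖ < 1 / 32) (ht : ‖t ^ 2‖ < 1 / 32) :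
    hornH4 q₀ q₁ (1 + q₀ - q₁) (2 * q₁) (baileyX s t) (baileyY s t) =
      (1 - s * t) ^ q₀ *
        ordinaryHypergeometric (q₀ / 2 + 1 / 2) (q₀ / 2) (q₀ - q₁ + 1) (1 - s ^ 2) *
        ordinaryHypergeometric (q₀ / 2 + 1 / 2) (q₀ / 2) (q₁ + 1 / 2) (t ^ 2) := by
  have e : q₀ - q₁ + 1 = 1 + q₀ - q₁ := by ring
  rw [hornH4]
  simp_rw [tsum_hornH4Term_eq q₀ q₁ _ hd hst]
  rw [tsum_mul_left, ← (summable_appellF4Term _ _ hc (add_half_ne hd) (norm_mul_one_sub_le hs ht)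
    (norm_mul_one_sub_le ht hs)).tsum_prod,
    appellF4_factorization hc (add_half_ne hd) (by ring) hs ht, e,
    ordinaryHypergeometric_eq_tsum_gaussTerm, ordinaryHypergeometric_eq_tsum_gaussTerm, mul_assoc]

/-! ### Analytic continuation -/

theorem differentiableOn_hornH4_comp (a b : ℂ) {c d : ℂ} (hc : ∀ n : ℕ, c ≠ -(n : ℂ))
    (hd : ∀ n : ℕ, d ≠ -(n : ℂ)) {V : Set ℂ} (hV : IsOpen V) {x y : ℂ → ℂ}
    (hx : DifferentiableOn ℂ x V) (hy : DifferentiableOn ℂ y V)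
    (h : ∀ w ∈ V, 2 * √‖x w‖ + ‖y w‖ < 1) :
    DifferentiableOn ℂ (fun w => hornH4 a b c d (x w) (y w)) V := by
  have heq : Set.EqOn (fun w => hornH4 a b c d (x w) (y w))
      (fun w => ∑' k, hornH4Term a b c d (x w) (y w) k) V := fun w hw =>
    hornH4_eq_tsum_prod a b hc hd (h w hw)
  refine DifferentiableOn.congr (fun w hw => ?_) heq
  -- The strict inequality leaves room for a polydisc around the arguments at `w` on which one
  -- majorant serves all nearby points.
  obtain ⟨ε, hε, hε'⟩ : ∃ ε : ℝ, 0 < ε ∧ 2 * √(‖x w‖ + ε) + (‖y w‖ + ε) < 1 := by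
    have : ContinuousAt (fun ε : ℝ => 2 * √(‖x w‖ + ε) + (‖y w‖ + ε)) 0 := by fun_prop
    have h2 := this.eventually_lt_const (u := 1) (by simpa using h w hw)
    obtain ⟨ε, h3, h4⟩ := ((h2.filter_mono nhdsWithin_le_nhds).and
      (self_mem_nhdsWithin (s := Set.Ioi (0 : ℝ)))).exists
    exact ⟨ε, h4, h3⟩
  obtain ⟨u, hu, hle⟩ := exists_bound_hornH4Term a b hc hd (r := ‖x w‖ + ε) (ρ := ‖y w‖ + ε)
    (by positivity) (by positivity) hε'
  have ho : IsOpen ((V ∩ x ⁻¹' Metric.ball 0 (‖x w‖ + ε)) ∩ (V ∩ y ⁻¹' Metric.ball 0 (‖y w‖ + ε))) :=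
    (hx.continuousOn.isOpen_inter_preimage hV Metric.isOpen_ball).inter
      (hy.continuousOn.isOpen_inter_preimage hV Metric.isOpen_ball)
  refine ((Complex.differentiableOn_tsum_of_summable_norm hu (fun k => ?_) ho
    fun k z hz => hle _ _ (mem_ball_zero_iff.1 hz.1.2).le (mem_ball_zero_iff.1 hz.2.2).le
      k).differentiableAt (ho.mem_nhds ⟨⟨hw, ?_⟩, hw, ?_⟩)).differentiableWithinAt
  · have hx' := hx.mono fun z (hz : z ∈ (V ∩ x ⁻¹' Metric.ball 0 (‖x w‖ + ε)) ∩
      (V ∩ y ⁻¹' Metric.ball 0 (‖y w‖ + ε))) => hz.1.1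
    have hy' := hy.mono fun z (hz : z ∈ (V ∩ x ⁻¹' Metric.ball 0 (‖x w‖ + ε)) ∩
      (V ∩ y ⁻¹' Metric.ball 0 (‖y w‖ + ε))) => hz.1.1
    unfold hornH4Term
    exact ((hx'.pow k.1).const_mul _).mul (hy'.pow k.2)
  · simpa using hε
  · simpa using hε

/-- A function holomorphic along complex lines that vanishes near a point of a preconnected open
set vanishes on that set. -/
theorem eqOn_zero_of_differentiableOn_lines {E : Type*} [NormedAddCommGroup E] [NormedSpace ℂ E]
    [NormedSpace ℝ E] [IsScalarTower ℝ ℂ E] {f : E → ℂ} {U : Set E} (hU : IsOpen U)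
    (hUc : IsPreconnected U)
    (hf : ∀ p v : E, DifferentiableOn ℂ (fun w : ℂ => f (p + w • v)) {w | p + w • v ∈ U})
    {p₀ : E} (hp₀ : p₀ ∈ U) (h₀ : f =ᶠ[nhds p₀] 0) : Set.EqOn f 0 U := by
  have hline (p v : E) : Continuous fun w : ℂ => p + w • v := by fun_prop
  -- The points near which `f` vanishes form an open set; by preconnectedness it remains to see that
  -- it is relatively closed in `U`.
  have hsub : U ⊆ {p | f =ᶠ[nhds p] 0} := by
    refine hUc.subset_of_closure_inter_subset isOpen_setOfPred_eventually_nhds ⟨p₀, hp₀, h₀⟩ ?_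
    rintro p ⟨hp, hpU⟩
    obtain ⟨ε, hε, hball⟩ := Metric.isOpen_iff.1 hU p hpU
    obtain ⟨q, hqS, hq⟩ := Metric.mem_closure_iff.1 hp ε hε
    rw [dist_comm] at hq
    refine Filter.eventually_of_mem (Metric.ball_mem_nhds p hε) fun r hr => ?_
    -- The line through `q` and `r` meets the ball in a convex set of parameters containing `0` (the
    -- point `q`) and `1` (the point `r`), so the one-variable identity theorem carries vanishing
    -- from `q` to `r`.
    set V : Set ℂ := {w | q + w • (r - q) ∈ Metric.ball p ε} with hV
    have hVo : IsOpen V := Metric.isOpen_ball.preimage (hline _ _)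
    have hVc : Convex ℝ V := fun w hw w' hw' a b ha hb hab => by
      have := convex_ball p ε hw hw' ha hb hab
      rw [hV, Set.mem_ofPred_eq]
      convert! this using 1
      rw [smul_add, smul_add, add_add_add_comm, ← add_smul, hab, one_smul, add_smul, smul_assoc,
        smul_assoc]
    have hg : AnalyticOnNhd ℂ (fun w : ℂ => f (q + w • (r - q))) V :=
      ((hf q (r - q)).mono fun w hw => hball hw).analyticOnNhd hVo
    have h0 : (fun w : ℂ => f (q + w • (r - q))) =ᶠ[nhds 0] 0 := by
      have ht : Filter.Tendsto (fun w : ℂ => q + w • (r - q)) (nhds 0) (nhds q) := by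
        simpa using (hline q (r - q)).tendsto 0
      exact ht.eventually hqS
    have := hg.eqOn_zero_of_preconnected_of_eventuallyEq_zero hVc.isPreconnected
      (show (0 : ℂ) ∈ V by simpa [hV] using hq) h0 (show (1 : ℂ) ∈ V by simpa [hV] using hr)
    simpa using this
  exact fun p hp => (hsub hp).eq_of_nhds

/-- From `|y| < 1` follows `2|st| < |st - 1| ≤ |st| + 1`. Hence `1 - st` has positive real part and
its principal power is holomorphic on the region. -/
theorem norm_mul_lt_one_of_mem_baileyRegion {p : ℂ × ℂ} (hp : p ∈ baileyRegion) :
    ‖p.1 * p.2‖ < 1 := by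
  obtain ⟨h1, h2, -, -⟩ := hp
  have h3 : ‖baileyY p.1 p.2‖ < 1 := by linarith [Real.sqrt_nonneg ‖baileyX p.1 p.2‖]
  have h4 : 0 < ‖p.1 * p.2 - 1‖ := norm_pos_iff.2 (sub_ne_zero.2 h1)
  rw [baileyY, norm_div, div_lt_one h4, mul_assoc, norm_mul, Complex.norm_ofNat] at h3
  have h5 := norm_sub_le (p.1 * p.2) 1
  rw [norm_one] at h5
  linarith

theorem isOpen_baileyRegion : IsOpen baileyRegion := by
  have ho : IsOpen {p : ℂ × ℂ | p.1 * p.2 ≠ 1} := isOpen_ne_fun (by fun_prop) (by fun_prop)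
  have hne : ∀ p ∈ {p : ℂ × ℂ | p.1 * p.2 ≠ 1}, p.1 * p.2 - 1 ≠ 0 := fun p hp => sub_ne_zero.2 hp
  have hX : ContinuousOn (fun p : ℂ × ℂ => baileyX p.1 p.2) {p : ℂ × ℂ | p.1 * p.2 ≠ 1} := by
    unfold baileyX
    exact ContinuousOn.div (by fun_prop) (by fun_prop) fun p hp =>
      mul_ne_zero (by norm_num) (pow_ne_zero 2 (hne p hp))
  have hY : ContinuousOn (fun p : ℂ × ℂ => baileyY p.1 p.2) {p : ℂ × ℂ | p.1 * p.2 ≠ 1} := by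
    unfold baileyY
    exact ContinuousOn.div (by fun_prop) (by fun_prop) hne
  have h1 := (((Real.continuous_sqrt.comp_continuousOn hX.norm).const_mul 2).add
    hY.norm).isOpen_inter_preimage ho (isOpen_Iio (a := (1 : ℝ)))
  have h2 : IsOpen {p : ℂ × ℂ | ‖1 - p.1 ^ 2‖ < 1} := isOpen_lt (by fun_prop) (by fun_prop)
  have h3 : IsOpen {p : ℂ × ℂ | ‖p.2 ^ 2‖ < 1} := isOpen_lt (by fun_prop) (by fun_prop)
  convert! h1.inter (h2.inter h3) using 1
  ext p
  simp only [baileyRegion, Set.mem_inter_iff, Set.mem_ofPred_eq, Set.mem_preimage, Set.mem_Iio,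
    Function.comp_apply, and_assoc]
  rfl

theorem one_zero_mem_baileyRegion : ((1, 0) : ℂ × ℂ) ∈ baileyRegion := by
  simp [baileyRegion, baileyX, baileyY]

/-- The difference of the two sides of the factorization of `H₄`. -/
noncomputable def baileyDefect (q₀ q₁ : ℂ) (p : ℂ × ℂ) : ℂ :=
  hornH4 q₀ q₁ (1 + q₀ - q₁) (2 * q₁) (baileyX p.1 p.2) (baileyY p.1 p.2) -
    (1 - p.1 * p.2) ^ q₀ *
      ordinaryHypergeometric (q₀ / 2 + 1 / 2) (q₀ / 2) (q₀ - q₁ + 1) (1 - p.1 ^ 2) *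
      ordinaryHypergeometric (q₀ / 2 + 1 / 2) (q₀ / 2) (q₁ + 1 / 2) (p.2 ^ 2)

theorem differentiableOn_baileyDefect_line {q₀ q₁ : ℂ}
    (hc : ∀ n : ℕ, 1 + q₀ - q₁ ≠ -(n : ℂ)) (hd : ∀ n : ℕ, 2 * q₁ ≠ -(n : ℂ)) (p v : ℂ × ℂ)
    {V : Set ℂ} (hVo : IsOpen V) (hVr : ∀ w ∈ V, p + w • v ∈ baileyRegion) :
    DifferentiableOn ℂ (fun w : ℂ => baileyDefect q₀ q₁ (p + w • v)) V := by
  have h1 : Differentiable ℂ fun w : ℂ => (p + w • v).1 := by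
    simp only [Prod.fst_add, Prod.smul_fst]; fun_prop
  have h2 : Differentiable ℂ fun w : ℂ => (p + w • v).2 := by
    simp only [Prod.snd_add, Prod.smul_snd]; fun_prop
  have hne : ∀ w ∈ V, (p + w • v).1 * (p + w • v).2 - 1 ≠ 0 := fun w hw =>
    sub_ne_zero.2 (hVr w hw).1
  have hX : DifferentiableOn ℂ (fun w => baileyX (p + w • v).1 (p + w • v).2) V := by
    unfold baileyX
    exact DifferentiableOn.div
      (((h1.pow 2).sub_const 1).mul ((h2.pow 2).sub_const 1)).differentiableOn
      ((((h1.mul h2).sub_const 1).pow 2).const_mul 4).differentiableOn fun w hw =>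
        mul_ne_zero (by norm_num) (pow_ne_zero 2 (hne w hw))
  have hY : DifferentiableOn ℂ (fun w => baileyY (p + w • v).1 (p + w • v).2) V := by
    unfold baileyY
    exact DifferentiableOn.div ((h1.const_mul 2).mul h2).differentiableOn
      ((h1.mul h2).sub_const 1).differentiableOn hne
  have hH := differentiableOn_hornH4_comp q₀ q₁ hc hd hVo hX hY fun w hw => (hVr w hw).2.1
  have hpow : DifferentiableOn ℂ
      (fun w => (1 - (p + w • v).1 * (p + w • v).2) ^ q₀) V := by
    refine ((h1.mul h2).const_sub 1).differentiableOn.cpow_const fun w hw => Or.inl ?_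
    have h3 := norm_mul_lt_one_of_mem_baileyRegion (hVr w hw)
    have h4 := Complex.re_le_norm ((p + w • v).1 * (p + w • v).2)
    simp only [Pi.mul_apply, Complex.sub_re, Complex.one_re]
    linarith
  have hc' : ∀ n : ℕ, q₀ - q₁ + 1 ≠ -(n : ℂ) := fun n h => hc n (by linear_combination h)
  have hF1 : DifferentiableOn ℂ (fun w => ordinaryHypergeometric (q₀ / 2 + 1 / 2) (q₀ / 2)
      (q₀ - q₁ + 1) (1 - (p + w • v).1 ^ 2)) V :=
    (differentiableOn_ordinaryHypergeometric _ _ hc').comp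
      ((h1.pow 2).const_sub 1).differentiableOn fun w hw =>
        mem_ball_zero_iff.2 (hVr w hw).2.2.1
  have hF2 : DifferentiableOn ℂ (fun w => ordinaryHypergeometric (q₀ / 2 + 1 / 2) (q₀ / 2)
      (q₁ + 1 / 2) ((p + w • v).2 ^ 2)) V :=
    (differentiableOn_ordinaryHypergeometric _ _ (add_half_ne hd)).comp
      (h2.pow 2).differentiableOn fun w hw => mem_ball_zero_iff.2 (hVr w hw).2.2.2
  exact hH.sub ((hpow.mul hF1).mul hF2)

theorem mainTheorem1 (q₀ q₁ : ℂ)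
    (hc : ∀ n : ℕ, 1 + q₀ - q₁ ≠ -(n : ℂ)) (hd : ∀ n : ℕ, 2 * q₁ ≠ -(n : ℂ)) :
    IsOpen baileyDomain ∧ ((1, 0) : ℂ × ℂ) ∈ baileyDomain ∧
      ∀ s t : ℂ, (s, t) ∈ baileyDomain →
        Summable (hornH4Term q₀ q₁ (1 + q₀ - q₁) (2 * q₁) (baileyX s t) (baileyY s t)) ∧
        hornH4 q₀ q₁ (1 + q₀ - q₁) (2 * q₁) (baileyX s t) (baileyY s t) =
          (1 - s * t) ^ q₀ *
            ordinaryHypergeometric (q₀ / 2 + 1 / 2) (q₀ / 2) (q₀ - q₁ + 1) (1 - s ^ 2) *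
            ordinaryHypergeometric (q₀ / 2 + 1 / 2) (q₀ / 2) (q₁ + 1 / 2) (t ^ 2) := by
  have hopen : IsOpen baileyDomain := isOpen_baileyRegion.connectedComponentIn
  have hmem : ((1, 0) : ℂ × ℂ) ∈ baileyDomain :=
    mem_connectedComponentIn one_zero_mem_baileyRegion
  have hsub : baileyDomain ⊆ baileyRegion := connectedComponentIn_subset _ _
  refine ⟨hopen, hmem, fun s t hst => ⟨summable_hornH4Term _ _ hc hd (hsub hst).2.1, ?_⟩⟩
  suffices h : Set.EqOn (baileyDefect q₀ q₁) 0 baileyDomain by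
    have h1 := h hst
    rw [baileyDefect, Pi.zero_apply, sub_eq_zero] at h1
    exact h1
  refine eqOn_zero_of_differentiableOn_lines hopen isPreconnected_connectedComponentIn
    (fun p v => differentiableOn_baileyDefect_line hc hd p v
      (hopen.preimage (f := fun w : ℂ => p + w • v) (by fun_prop)) fun w hw => hsub hw) hmem ?_
  have hlt {g : ℂ × ℂ → ℂ} (hg : Continuous g) (hg0 : g (1, 0) = 0) {ε : ℝ} (hε : 0 < ε) :
      ∀ᶠ p in nhds ((1, 0) : ℂ × ℂ), ‖g p‖ < ε :=
    hg.norm.continuousAt.eventually_lt_const (by simpa [hg0] using hε)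
  filter_upwards [hlt (g := fun p => p.1 * p.2) (by fun_prop) (by simp)
      (show (0 : ℝ) < 1 / 3 by norm_num),
    hlt (g := fun p => 1 - p.1 ^ 2) (by fun_prop) (by simp) (show (0 : ℝ) < 1 / 32 by norm_num),
    hlt (g := fun p => p.2 ^ 2) (by fun_prop) (by simp) (show (0 : ℝ) < 1 / 32 by norm_num)]
    with p h1 h2 h3
  rw [baileyDefect, Pi.zero_apply, sub_eq_zero]
  exact hornH4_eq_of_small hc hd h1 h2 h3
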